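/- Let $m\ge 1$ be an integer, $0\le t_0<T$, and let $\mathcal K\subset\mathbb R^m$ be compact and nonempty; $|\cdot|$ is the Euclidean norm. Let $f:[0,T]\times\mathbb R^m\times\mathcal K\to\mathbb R^m$ and $g:[0,T]\times\mathbb R^m\times\mathbb R^m\to\mathbb R^m$ be continuous functions for which there is a constant $L\ge 0$ with $|f(t,x,\tau)|+|g(t,x,\xi)|\le L(1+|x|)$ and $|g(t,x,\xi)-g(t,x',\xi)|+|f(t,x,\tau)-f(t,x',\tau)|\le L|x-x'|$ for all $t\in[0,T]$, $\tau\in\mathcal K$ and $x,x',\xi\in\mathbb R^m$. Let the impulse cost $C:[0,T]\times\mathbb R^m\times\mathbb R^m\to\mathbb R$ be continuous with $|C(t,x,\xi)|\le L(1+|x|)$ and $C(t,x,\xi)\ge\alpha$ for some constants $L$ and $\alpha>0$; let the running cost $\psi:[0,T]\times\mathbb R^m\times\mathcal K\to\mathbb R$ be continuous and bounded from below with $|\psi(t,x,\tau)|\le L(1+|x|)$ for some constant $L$; and let $G:\mathbb R^m\to\mathbb R$ be uniformly continuous and bounded from below with $|G(x)|\le L(1+|x|)$ for some constant $L$. Several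 successive jumps may be made at the same time: for a finite sequence $\xi=(\xi_1,\dots,\xi_n)$ of elements of $\mathbb R^m$, $n\ge1$, put $x_0=x$, $x_k=x_{k-1}+g(t,x_{k-1},\xi_k)$, and write $x+g(t,x,\xi):=x_n$ and $C(t,x,\xi):=\sum_{k=1}^n C(t,x_{k-1},\xi_k)$. Fix a constant $c\in(0,\infty]$ and let $E=E(x)$ be the set of such sequences whose length satisfies $n\le c(1+|x|)$ (no restriction if $c=\infty$). Put $$N[v](t,x)=\inf_{\xi\in E}\big[v(t,x+g(t,x,\xi))+C(t,x,\xi)\big]\qquad(\inf\emptyset=+\infty),$$ and $G_1(x)=\min\{G(x),N[G](T,x)\}$, where $N[G](T,x)=\inf_{\xi\in E}[G(x+g(T,x,\xi))+C(T,x,\xi)]$. Consider the quasi-variational inequality $$\max\Big\{\min_{\tau\in\mathcal K}\Big[-\frac{\partial v}{\partial t}-\frac{\partial v}{\partial x}f(t,x,\tau)-\psi(t,x,\tau)\Big],\;v(t,x)-N[v](t,x)\Big\}=0\quad\text{on }[t_0,T[\times\mathbb R^m,\qquad v(T,x)=G_1(x).\tag{1}$$ A continuous function $v:[t_0,T]\times\mathbb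 R^m\to\mathbb R$ with $v(T,\cdot)=G_1$ is a viscosity supersolution (resp. subsolution) of (1) if for every $\varphi\in C^{1,2}([t_0,T[\times\mathbb R^m)$ and every $(\bar t,\bar x)\in[t_0,T[\times\mathbb R^m$ such that $\varphi(\bar t,\bar x)=v(\bar t,\bar x)$ and $(\bar t,\bar x)$ is a local maximum (resp. minimum) of $\varphi-v$ in $[t_0,T[\times\mathbb R^m$, $$\max\Big\{\min_{\tau\in\mathcal K}\Big[-\frac{\partial\varphi}{\partial t}(\bar t,\bar x)-\frac{\partial\varphi}{\partial x}(\bar t,\bar x)f(\bar t,\bar x,\tau)-\psi(\bar t,\bar x,\tau)\Big],\;v(\bar t,\bar x)-N[v](\bar t,\bar x)\Big\}\ge0\quad(\text{resp. }\le0).$$ It is a viscosity solution if it is both. Theorem. There is at most one viscosity solution of (1) in the class of continuous functions $v:[t_0,T]\times\mathbb R^m\to\mathbb R$ that are bounded from below and satisfy $v(t,x)\le L(1+|x|)$ for all $(t,x)\in[t_0,T]\times\mathbb R^m$, for some constant $L$ (depending on $v$). -/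

import Mathlib

open Set
open scoped ENNReal

/-- The state space `ℝ^m` with the Euclidean norm. -/
abbrev State (m : ℕ) : Type := EuclideanSpace ℝ (Fin m)

/-- The data of the finite-horizon impulse control problem (no property is assumed here; see
`ImpulseProblem.Standing`). -/
structure ImpulseProblem (m : ℕ) where
  /-- the horizon -/
  T : ℝ
  /-- the set of values of the continuous control -/
  K : Set (State m)
  /-- the drift `f(t,x,τ)` -/
  f : ℝ → State m → State m → State m
  /-- the jump `g(t,x,ξ)` -/
  g : ℝ → State m → State m → State m
  /-- the impulse cost `C(t,x,ξ)` -/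
  cost : ℝ → State m → State m → ℝ
  /-- the running cost `ψ(t,x,τ)` -/
  psi : ℝ → State m → State m → ℝ
  /-- the terminal cost -/
  G : State m → ℝ
  /-- at the state `x`, at most `c (1 + |x|)` successive simultaneous jumps are allowed;
  `c = ∞` means that there is no bound on their number -/
  c : ℝ≥0∞

namespace ImpulseProblem

variable {m : ℕ}

/-- The standing assumptions on the data. -/
structure Standing (P : ImpulseProblem m) : Prop where
  isCompact_K : IsCompact P.K
  nonempty_K : P.K.Nonempty
  c_pos : 0 < P.c
  continuousOn_f : ContinuousOn (fun p : ℝ × State m × State m => P.f p.1 p.2.1 p.2.2)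
    (Icc 0 P.T ×ˢ (univ ×ˢ P.K))
  continuousOn_g : ContinuousOn (fun p : ℝ × State m × State m => P.g p.1 p.2.1 p.2.2)
    (Icc 0 P.T ×ˢ (univ ×ˢ univ))
  growth_lipschitz_f_g : ∃ C : ℝ, 0 ≤ C ∧ ∀ t ∈ Icc 0 P.T, ∀ τ ∈ P.K, ∀ ξ x x' : State m,
    ‖P.f t x τ‖ + ‖P.g t x ξ‖ ≤ C * (1 + ‖x‖) ∧
    ‖P.g t x ξ - P.g t x' ξ‖ + ‖P.f t x τ - P.f t x' τ‖ ≤ C * ‖x - x'‖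
  continuousOn_cost : ContinuousOn (fun p : ℝ × State m × State m => P.cost p.1 p.2.1 p.2.2)
    (Icc 0 P.T ×ˢ (univ ×ˢ univ))
  growth_cost : ∃ C : ℝ, ∀ t ∈ Icc 0 P.T, ∀ x ξ : State m, |P.cost t x ξ| ≤ C * (1 + ‖x‖)
  cost_ge : ∃ α : ℝ, 0 < α ∧ ∀ t ∈ Icc 0 P.T, ∀ x ξ : State m, α ≤ P.cost t x ξ
  continuousOn_psi : ContinuousOn (fun p : ℝ × State m × State m => P.psi p.1 p.2.1 p.2.2)
    (Icc 0 P.T ×ˢ (univ ×ˢ P.K))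
  growth_psi : ∃ C : ℝ, ∀ t ∈ Icc 0 P.T, ∀ x : State m, ∀ τ ∈ P.K,
    |P.psi t x τ| ≤ C * (1 + ‖x‖)
  psi_ge : ∃ b : ℝ, ∀ t ∈ Icc 0 P.T, ∀ x : State m, ∀ τ ∈ P.K, b ≤ P.psi t x τ
  uniformContinuous_G : UniformContinuous P.G
  growth_G : ∃ C : ℝ, ∀ x : State m, |P.G x| ≤ C * (1 + ‖x‖)
  G_ge : ∃ b : ℝ, ∀ x : State m, b ≤ P.G x

/-- The state reached from `x` after the successive jumps `ξ₁, …, ξₙ`, all made at time `t`. -/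
def stateAfter (P : ImpulseProblem m) (t : ℝ) : State m → List (State m) → State m
  | x, [] => x
  | x, ξ :: l => stateAfter P t (x + P.g t x ξ) l

/-- The total cost of the successive jumps `ξ₁, …, ξₙ`, all made at time `t`, from `x`. -/
def costOf (P : ImpulseProblem m) (t : ℝ) : State m → List (State m) → ℝ
  | _, [] => 0
  | x, ξ :: l => P.cost t x ξ + costOf P t (x + P.g t x ξ) l

/-- The set `E` of admissible finite sequences of `n ≥ 1` simultaneous jumps at the state `x`:
those with `1 ≤ c (1 + |x|) / n`. -/
def jumps (P : ImpulseProblem m) (x : State m) : Set (List (State m)) :=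
  {l | l ≠ [] ∧ (l.length : ℝ≥0∞) ≤ P.c * ENNReal.ofReal (1 + ‖x‖)}

/-- `inf_{ξ ∈ E} [h(x + g(t,x,ξ)) + C(t,x,ξ)]`, where `g` and `C` are extended to sequences of
jumps; an infimum in `[-∞,+∞]`, equal to `+∞` where no jump is admissible. -/
noncomputable def jumpInf (P : ImpulseProblem m) (h : State m → ℝ) (t : ℝ) (x : State m) :
    EReal :=
  ⨅ l ∈ P.jumps x, ((h (P.stateAfter t x l) + P.costOf t x l : ℝ) : EReal)

/-- The operator `N`. -/
noncomputable def N (P : ImpulseProblem m) (v : ℝ → State m → ℝ) (t : ℝ) (x : State m) : EReal :=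
  P.jumpInf (v t) t x

/-- The terminal value `G₁ = min {G, N[G](T,·)}`. -/
noncomputable def G₁ (P : ImpulseProblem m) (x : State m) : EReal :=
  min (P.G x : EReal) (P.jumpInf P.G P.T x)

/-- `min_{τ ∈ K} [-a - ⟨q, f(t,x,τ)⟩ - ψ(t,x,τ)]`. -/
noncomputable def hamiltonian (P : ImpulseProblem m) (t : ℝ) (x : State m) (a : ℝ)
    (q : State m →L[ℝ] ℝ) : ℝ :=
  ⨅ τ : P.K, (-a - q (P.f t x τ) - P.psi t x τ)

/-- The left-hand side of the quasi-variational inequality at `(t,x)` for `v`, with the values `a`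
and `q` in the place of `∂v/∂t` and `∂v/∂x`. -/
noncomputable def qvi (P : ImpulseProblem m) (v : ℝ → State m → ℝ) (t : ℝ) (x : State m) (a : ℝ)
    (q : State m →L[ℝ] ℝ) : EReal :=
  max (P.hamiltonian t x a q : EReal) ((v t x : EReal) - P.N v t x)

/-- `φ ∈ C^{1,2}([t₀,T[ × ℝ^m)`, with time derivative `φt` (one-sided at `t₀`) and space
derivative `φx`. -/
def IsC12 (t₀ T : ℝ) (φ φt : ℝ → State m → ℝ) (φx : ℝ → State m → State m →L[ℝ] ℝ) : Prop :=
  ∃ φxx : ℝ → State m → State m →L[ℝ] State m →L[ℝ] ℝ,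
    (∀ t ∈ Ico t₀ T, ∀ x : State m,
      HasDerivWithinAt (fun s => φ s x) (φt t x) (Ico t₀ T) t ∧
      HasFDerivAt (φ t) (φx t x) x ∧
      HasFDerivAt (φx t) (φxx t x) x) ∧
    ContinuousOn (fun p : ℝ × State m => φ p.1 p.2) (Ico t₀ T ×ˢ univ) ∧
    ContinuousOn (fun p : ℝ × State m => φt p.1 p.2) (Ico t₀ T ×ˢ univ) ∧
    ContinuousOn (fun p : ℝ × State m => φx p.1 p.2) (Ico t₀ T ×ˢ univ) ∧
    ContinuousOn (fun p : ℝ × State m => φxx p.1 p.2) (Ico t₀ T ×ˢ univ)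

/-- What is required of sub- and supersolutions alike: continuity on `[t₀,T] × ℝ^m` and the
terminal condition `v(T,·) = G₁`. -/
def IsCandidate (P : ImpulseProblem m) (t₀ : ℝ) (v : ℝ → State m → ℝ) : Prop :=
  ContinuousOn (fun p : ℝ × State m => v p.1 p.2) (Icc t₀ P.T ×ˢ univ) ∧
  ∀ x : State m, (v P.T x : EReal) = P.G₁ x

/-- Viscosity supersolutions of the quasi-variational inequality. -/
def IsViscositySupersolution (P : ImpulseProblem m) (t₀ : ℝ) (v : ℝ → State m → ℝ) : Prop :=
  P.IsCandidate t₀ v ∧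
  ∀ (φ φt : ℝ → State m → ℝ) (φx : ℝ → State m → State m →L[ℝ] ℝ), IsC12 t₀ P.T φ φt φx →
    ∀ t ∈ Ico t₀ P.T, ∀ x : State m, φ t x = v t x →
      IsLocalMaxOn (fun p : ℝ × State m => φ p.1 p.2 - v p.1 p.2) (Ico t₀ P.T ×ˢ univ) (t, x) →
      0 ≤ P.qvi v t x (φt t x) (φx t x)

/-- Viscosity subsolutions of the quasi-variational inequality. -/
def IsViscositySubsolution (P : ImpulseProblem m) (t₀ : ℝ) (v : ℝ → State m → ℝ) : Prop :=
  P.IsCandidate t₀ v ∧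
  ∀ (φ φt : ℝ → State m → ℝ) (φx : ℝ → State m → State m →L[ℝ] ℝ), IsC12 t₀ P.T φ φt φx →
    ∀ t ∈ Ico t₀ P.T, ∀ x : State m, φ t x = v t x →
      IsLocalMinOn (fun p : ℝ × State m => φ p.1 p.2 - v p.1 p.2) (Ico t₀ P.T ×ˢ univ) (t, x) →
      P.qvi v t x (φt t x) (φx t x) ≤ 0

/-- Viscosity solutions of the quasi-variational inequality with terminal condition `G₁`. -/
def IsViscositySolution (P : ImpulseProblem m) (t₀ : ℝ) (v : ℝ → State m → ℝ) : Prop :=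
  P.IsViscositySupersolution t₀ v ∧ P.IsViscositySubsolution t₀ v

/-- The class of continuous functions on `[t₀,T] × ℝ^m` that are bounded from below and at most
`C (1 + |x|)` for some constant `C`. -/
def GrowthClass (t₀ T : ℝ) : Set (ℝ → State m → ℝ) :=
  {v | ContinuousOn (fun p : ℝ × State m => v p.1 p.2) (Icc t₀ T ×ˢ univ) ∧
    (∃ C : ℝ, ∀ t ∈ Icc t₀ T, ∀ x : State m, v t x ≤ C * (1 + ‖x‖)) ∧
    ∃ b : ℝ, ∀ t ∈ Icc t₀ T, ∀ x : State m, b ≤ v t x}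

end ImpulseProblem

/-! The core is a comparison principle: a subsolution `u` lies below a supersolution `v` when both
are bounded below. Uniqueness follows by exchanging the roles. Put `p = exp (κt + β - u)` and `r =
exp (κt + β - v)`, both with values in `(0,1]`. Growth at infinity disappears, a jump cost becomes a
factor `exp (-C) ≤ exp (-α)`, so that the obstacle turns into a contraction, and `κ` makes the
zero-order coefficient `ψ + κ` nonnegative.

If `r > p` somewhere, the variables are doubled, with the penalty `δ log (1 + |x|²)`. Its derivative
along the drift is bounded, and each jump raises it by at most a constant `Λ`. At a maximum the
supersolution offers two alternatives. The drift one is refuted by `penalty_le_of_viscosity`, the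
jump one by `jump_contraction_absurd`: a chain of `n` jumps costs `δnΛ`, but `n exp (-C) ≤ 1/α`, so
long chains do no harm. The inequality is of first order, so quadratic test functions suffice, and
all parameters stay fixed: no limit is taken.

The maximum touches `p` at `(t,x)`, whereas the obstacle inequality for `u` is needed at `(s,y)`;
`IsViscositySubsolution.le_jump` provides it everywhere, because touching points are dense. -/

open Filter Topology

/-! ### Quadratic test functions and finite chains of jumps -/

/-- The polynomial `a (s - t) + q (y - x) + M ((s - t)² + |y - x|²)` of second degree. -/
noncomputable def quadAt {m : ℕ} (t : ℝ) (x : State m) (a : ℝ) (q : State m →L[ℝ] ℝ) (M : ℝ)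
    (s : ℝ) (y : State m) : ℝ :=
  a * (s - t) + q (y - x) + M * ((s - t) ^ 2 + ‖y - x‖ ^ 2)

theorem continuous_quadAt {m : ℕ} (t : ℝ) (x : State m) (a : ℝ) (q : State m →L[ℝ] ℝ) (M : ℝ) :
    Continuous (fun p : ℝ × State m => quadAt t x a q M p.1 p.2) := by
  unfold quadAt; fun_prop

theorem isC12_quadAt {m : ℕ} (t₀ T t : ℝ) (x : State m) (a : ℝ) (q : State m →L[ℝ] ℝ) (M c : ℝ) :
    ImpulseProblem.IsC12 t₀ T (fun s y => c + quadAt t x a q M s y)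
      (fun s _ => a + 2 * M * (s - t))
      (fun _ y => q + (2 * M) • (innerSL ℝ (y - x) : State m →L[ℝ] ℝ)) := by
  refine ⟨fun _ _ => (2 * M) • (isBoundedBilinearMap_inner (𝕜 := ℝ)
    (E := State m)).toContinuousLinearMap, fun s _ y => ⟨?_, ?_, ?_⟩, ?_, ?_, ?_, ?_⟩
  · apply HasDerivAt.hasDerivWithinAt
    have h1 : HasDerivAt (fun s : ℝ => s - t) 1 s := (hasDerivAt_id s).sub_const t
    have := (((h1.const_mul a).add_const (q (y - x))).add
      (((h1.pow 2).add_const (‖y - x‖ ^ 2)).const_mul M)).const_add c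
    refine this.congr_deriv ?_
    simp; ring
  · have h1 : HasFDerivAt (fun y : State m => y - x) (ContinuousLinearMap.id ℝ (State m)) y :=
      (hasFDerivAt_id y).sub_const x
    have := (((q.hasFDerivAt.comp y h1).const_add (a * (s - t))).add
      ((h1.norm_sq.const_add ((s - t) ^ 2)).const_mul M)).const_add c
    refine this.congr_fderiv ?_
    ext z
    simp; ring
  · have h1 : HasFDerivAt (fun y : State m => y - x) (ContinuousLinearMap.id ℝ (State m)) y :=
      (hasFDerivAt_id y).sub_const x
    have := (((2 * M) • (isBoundedBilinearMap_inner (𝕜 := ℝ)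
      (E := State m)).toContinuousLinearMap).hasFDerivAt.comp y h1).const_add q
    refine (this.congr_fderiv ?_)
    ext z
    simp
  · exact (continuous_const.add (continuous_quadAt t x a q M)).continuousOn
  · fun_prop
  · fun_prop
  · exact continuousOn_const

namespace ImpulseProblem

variable {m : ℕ} {P : ImpulseProblem m} {t₀ : ℝ} {v : ℝ → State m → ℝ}

theorem IsViscositySubsolution.qvi_nonpos (h : P.IsViscositySubsolution t₀ v) {t : ℝ}
    (ht : t ∈ Ico t₀ P.T) {x : State m} {a : ℝ} {q : State m →L[ℝ] ℝ} {M : ℝ}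
    (hv : ∀ᶠ p in 𝓝[Ico t₀ P.T ×ˢ univ] (t, x), v p.1 p.2 ≤ v t x + quadAt t x a q M p.1 p.2) :
    P.qvi v t x a q ≤ 0 := by
  have := h.2 _ _ _ (isC12_quadAt t₀ P.T t x a q M (v t x)) t ht x (by simp [quadAt]) (by
    filter_upwards [hv] with p hp
    simp only [quadAt, sub_self] at hp ⊢
    simp [-map_sub]
    linarith)
  simpa using this

theorem IsViscositySupersolution.qvi_nonneg (h : P.IsViscositySupersolution t₀ v) {t : ℝ}
    (ht : t ∈ Ico t₀ P.T) {x : State m} {a : ℝ} {q : State m →L[ℝ] ℝ} {M : ℝ}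
    (hv : ∀ᶠ p in 𝓝[Ico t₀ P.T ×ˢ univ] (t, x), v t x + quadAt t x a q M p.1 p.2 ≤ v p.1 p.2) :
    0 ≤ P.qvi v t x a q := by
  have := h.2 _ _ _ (isC12_quadAt t₀ P.T t x a q M (v t x)) t ht x (by simp [quadAt]) (by
    filter_upwards [hv] with p hp
    simp only [quadAt, sub_self] at hp ⊢
    simp [-map_sub]
    linarith)
  simpa using this

theorem continuousOn_jump (hP : P.Standing) {S : Set (ℝ × State m)} (l : List (State m))
    {z : ℝ × State m → State m} (hS : ∀ p ∈ S, p.1 ∈ Icc 0 P.T) (hz : ContinuousOn z S) :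
    ContinuousOn (fun p => P.stateAfter p.1 (z p) l) S ∧
      ContinuousOn (fun p => P.costOf p.1 (z p) l) S := by
  induction l generalizing z with
  | nil => exact ⟨hz, continuousOn_const⟩
  | cons ξ l ih =>
    have hmap : ContinuousOn (fun p : ℝ × State m => (p.1, z p, ξ)) S :=
      continuousOn_fst.prodMk (hz.prodMk continuousOn_const)
    have hmem : MapsTo (fun p : ℝ × State m => (p.1, z p, ξ)) S
        (Icc 0 P.T ×ˢ (univ ×ˢ univ)) := fun p hp => ⟨hS p hp, mem_univ _, mem_univ _⟩
    have h := ih (hz.add (hP.continuousOn_g.comp hmap hmem))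
    exact ⟨h.1, (hP.continuousOn_cost.comp hmap hmem).add h.2⟩

/-- The bound on the number of jumps grows with the norm, so a chain survives a perturbation of the
state only if the norm does not decrease. -/
theorem jumps_mono {x y : State m} (hxy : ‖x‖ ≤ ‖y‖) : P.jumps x ⊆ P.jumps y := fun l hl =>
  ⟨hl.1, hl.2.trans (by gcongr)⟩

theorem jumpInf_le {h : State m → ℝ} {t : ℝ} {x : State m} {l : List (State m)}
    (hl : l ∈ P.jumps x) :
    P.jumpInf h t x ≤ ((h (P.stateAfter t x l) + P.costOf t x l : ℝ) : EReal) :=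
  iInf₂_le l hl

theorem le_N_of_qvi_nonpos {t : ℝ} {x : State m} {a : ℝ} {q : State m →L[ℝ] ℝ}
    (h : P.qvi v t x a q ≤ 0) {l : List (State m)} (hl : l ∈ P.jumps x) :
    v t x ≤ v t (P.stateAfter t x l) + P.costOf t x l := by
  have h1 : (v t x : EReal) - P.N v t x ≤ 0 := (le_max_right _ _).trans h
  have h2 : (v t x : EReal) ≤ P.N v t x := by
    refine (EReal.sub_nonpos.1 h1)
  exact EReal.coe_le_coe_iff.1 (h2.trans (jumpInf_le hl))

end ImpulseProblem

/-! ### Density of touching points and the obstacle inequality -/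

/-- Arbitrarily close to every point, a continuous function on `[t₀,T[ × ℝ^m` is touched from above
by a polynomial of second degree. -/
theorem exists_touching_quadAt {m : ℕ} {t₀ T : ℝ} {v : ℝ → State m → ℝ}
    (hv : ContinuousOn (fun p : ℝ × State m => v p.1 p.2) (Ico t₀ T ×ˢ univ))
    {W : Set (ℝ × State m)} (hW : IsOpen W) {t : ℝ} (ht : t ∈ Ico t₀ T) {z : State m}
    (hz : (t, z) ∈ W) :
    ∃ s ∈ Ico t₀ T, ∃ y : State m, (s, y) ∈ W ∧ ∃ (a : ℝ) (q : State m →L[ℝ] ℝ) (M : ℝ),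
      ∀ᶠ p in 𝓝[Ico t₀ T ×ˢ univ] (s, y), v p.1 p.2 ≤ v s y + quadAt s y a q M p.1 p.2 := by
  obtain ⟨r₁, hr₁, hball⟩ := Metric.nhds_basis_closedBall.mem_iff.1 (hW.mem_nhds hz)
  -- Staying below `T` keeps the compact cylinder `Q` inside the half-open time interval.
  obtain ⟨r, hr, hr₂, hrT⟩ : ∃ r > 0, r ≤ r₁ ∧ t + r < T := by
    refine ⟨min r₁ ((T - t) / 2), lt_min hr₁ (by linarith [ht.2]), min_le_left _ _, ?_⟩
    linarith [min_le_right r₁ ((T - t) / 2), ht.2]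
  set Q : Set (ℝ × State m) := Icc (max t₀ (t - r)) (t + r) ×ˢ Metric.closedBall z r with hQ
  have hQc : IsCompact Q := isCompact_Icc.prod (isCompact_closedBall z r)
  have hQS : Q ⊆ Ico t₀ T ×ˢ univ := fun p hp =>
    ⟨⟨(le_max_left _ _).trans hp.1.1, hp.1.2.trans_lt hrT⟩, mem_univ _⟩
  have htQ : (t, z) ∈ Q :=
    ⟨⟨max_le ht.1 (by linarith), by simp [hr.le]⟩, by simp [hr.le]⟩
  obtain ⟨B, hB⟩ := hQc.exists_bound_of_continuousOn (hv.mono hQS)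
  have hB' : ∀ p ∈ Q, |v p.1 p.2| ≤ B := hB
  have hB0 : 0 ≤ B := (abs_nonneg _).trans (hB' _ htQ)
  -- At distance `r` the penalty exceeds the oscillation `2B`, so the maximum is not on the lateral
  -- boundary or at the top. It may lie at time `t₀`, which is harmless because neighbourhoods are
  -- relative.
  set M : ℝ := (2 * B + 1) / r ^ 2 with hM
  have hMr : M * r ^ 2 = 2 * B + 1 := by rw [hM]; field_simp
  have hM0 : 0 < M := by positivity
  obtain ⟨⟨s, y⟩, hsy, hmax⟩ := hQc.exists_isMaxOn ⟨_, htQ⟩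
    (f := fun p : ℝ × State m => v p.1 p.2 - M * ((p.1 - t) ^ 2 + ‖p.2 - z‖ ^ 2))
    ((hv.mono hQS).sub (by fun_prop))
  have h0 : v t z ≤ v s y - M * ((s - t) ^ 2 + ‖y - z‖ ^ 2) := by simpa using hmax htQ
  have hlt : (s - t) ^ 2 + ‖y - z‖ ^ 2 < r ^ 2 := by
    have h1 := abs_le.1 (hB' _ htQ)
    have h2 := abs_le.1 (hB' _ hsy)
    simp only at h1 h2
    by_contra hcon
    have := mul_le_mul_of_nonneg_left (not_lt.1 hcon) hM0.le
    linarith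
  have hs : |s - t| < r := abs_lt_of_sq_lt_sq (by nlinarith [sq_nonneg ‖y - z‖]) hr.le
  have hy : ‖y - z‖ < r := by
    refine lt_of_pow_lt_pow_left₀ 2 hr.le (by nlinarith [sq_nonneg (s - t)])
  refine ⟨s, (hQS hsy).1, y, hball ?_, 2 * M * (s - t),
    (2 * M) • (innerSL ℝ (y - z) : State m →L[ℝ] ℝ), M, ?_⟩
  · rw [Metric.mem_closedBall, Prod.dist_eq, dist_eq_norm, dist_eq_norm, Real.norm_eq_abs]
    exact max_le (hs.le.trans hr₂) (hy.le.trans hr₂)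
  have hnear : ∀ᶠ p in 𝓝 (s, y), |p.1 - t| < r ∧ ‖p.2 - z‖ < r :=
    ((continuous_fst.sub continuous_const).abs.continuousAt.eventually_lt
      continuousAt_const hs).and
    ((continuous_snd.sub continuous_const).norm.continuousAt.eventually_lt
      continuousAt_const hy)
  filter_upwards [mem_nhdsWithin_of_mem_nhds hnear, self_mem_nhdsWithin] with p hp hpS
  have hp1 := abs_lt.1 hp.1
  have hpQ : p ∈ Q := ⟨⟨max_le hpS.1.1 (by linarith), by linarith⟩, by
    rw [Metric.mem_closedBall, dist_eq_norm]; exact hp.2.le⟩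
  have h1 : v p.1 p.2 - M * ((p.1 - t) ^ 2 + ‖p.2 - z‖ ^ 2)
      ≤ v s y - M * ((s - t) ^ 2 + ‖y - z‖ ^ 2) := hmax hpQ
  have h2 : ‖p.2 - z‖ ^ 2 = ‖y - z‖ ^ 2 + 2 * inner ℝ (y - z) (p.2 - y) + ‖p.2 - y‖ ^ 2 := by
    rw [← norm_add_sq_real]; congr 2; abel
  have h3 : ((2 * M) • (innerSL ℝ (y - z) : State m →L[ℝ] ℝ)) (p.2 - y)
      = 2 * M * inner ℝ (y - z) (p.2 - y) := by
    simp [inner_sub_left]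
  rw [quadAt, h3]
  rw [h2] at h1
  nlinarith

namespace ImpulseProblem

variable {m : ℕ} {P : ImpulseProblem m} {t₀ : ℝ} {v : ℝ → State m → ℝ}

/-- In positive dimension the complement of a closed ball accumulates at its sphere; this lets the
state be approximated by states of larger norm. -/
theorem mem_closure_norm_lt (hm : 0 < m) (x : State m) : x ∈ closure {y : State m | ‖x‖ < ‖y‖} := by
  have : Nonempty (Fin m) := ⟨⟨0, hm⟩⟩
  have h : {y : State m | ‖x‖ < ‖y‖} = (Metric.closedBall (0 : State m) ‖x‖)ᶜ := by
    ext y; simp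
  rw [h, closure_compl, interior_closedBall']
  simp

/-- A subsolution lies below the obstacle `N[v]` everywhere on `[t₀,T[ × ℝ^m`. -/
theorem IsViscositySubsolution.le_jump (hm : 0 < m) (hP : P.Standing) (ht₀ : 0 ≤ t₀)
    (h : P.IsViscositySubsolution t₀ v) {t : ℝ} (ht : t ∈ Ico t₀ P.T) {x : State m}
    {l : List (State m)} (hl : l ∈ P.jumps x) :
    v t x ≤ v t (P.stateAfter t x l) + P.costOf t x l := by
  by_contra! hcon
  have hv : ContinuousOn (fun p : ℝ × State m => v p.1 p.2) (Ico t₀ P.T ×ˢ univ) :=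
    h.1.1.mono (prod_mono Ico_subset_Icc_self subset_rfl)
  have hj := continuousOn_jump hP (S := Ico t₀ P.T ×ˢ (univ : Set (State m))) l
    (z := Prod.snd) (fun p hp => ⟨ht₀.trans hp.1.1, hp.1.2.le⟩) continuousOn_snd
  have hF : ContinuousOn (fun p : ℝ × State m =>
      v p.1 (P.stateAfter p.1 p.2 l) + P.costOf p.1 p.2 l) (Ico t₀ P.T ×ˢ univ) :=
    (hv.comp (continuousOn_fst.prodMk hj.1) (fun p hp => ⟨hp.1, mem_univ _⟩)).add hj.2
  have htx : (t, x) ∈ Ico t₀ P.T ×ˢ (univ : Set (State m)) := ⟨ht, mem_univ _⟩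
  obtain ⟨O, hO, hxO, hOS⟩ := mem_nhdsWithin.1
    ((hF _ htx).eventually_lt (hv _ htx) hcon)
  -- First move to a state of larger norm, then to a touching point nearby: the violated inequality
  -- persists and `l` remains admissible.
  obtain ⟨z, hzO, hzx⟩ := mem_closure_iff.1 (mem_closure_norm_lt hm x) {y | (t, y) ∈ O}
    (hO.preimage (by fun_prop)) hxO
  obtain ⟨s, hs, y, ⟨hyO, hyx⟩, a, q, M, htouch⟩ := exists_touching_quadAt hv
    (hO.inter (isOpen_lt continuous_const continuous_snd.norm :
      IsOpen {p : ℝ × State m | ‖x‖ < ‖p.2‖})) ht ⟨hzO, hzx⟩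
  have h1 := le_N_of_qvi_nonpos (h.qvi_nonpos hs htouch) (jumps_mono (le_of_lt hyx) hl)
  have h2 : v s (P.stateAfter s y l) + P.costOf s y l < v s y :=
    hOS ⟨hyO, hs, mem_univ _⟩
  exact absurd h1 (not_le.2 h2)

/-! ### Pointwise consequences of the two alternatives -/

theorem continuousOn_hamiltonian_integrand (hP : P.Standing) {t : ℝ} (ht : t ∈ Icc 0 P.T)
    (x : State m) (a : ℝ) (q : State m →L[ℝ] ℝ) :
    ContinuousOn (fun τ => -a - q (P.f t x τ) - P.psi t x τ) P.K := by
  have hmap : ContinuousOn (fun τ : State m => (t, x, τ)) P.K := by fun_prop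
  have hmem : MapsTo (fun τ : State m => (t, x, τ)) P.K (Icc 0 P.T ×ˢ (univ ×ˢ P.K)) :=
    fun τ hτ => ⟨ht, mem_univ _, hτ⟩
  exact (continuousOn_const.sub (q.continuous.comp_continuousOn
    (hP.continuousOn_f.comp hmap hmem))).sub (hP.continuousOn_psi.comp hmap hmem)

theorem exists_of_hamiltonian_nonpos (hP : P.Standing) {t : ℝ} (ht : t ∈ Icc 0 P.T)
    {x : State m} {a : ℝ} {q : State m →L[ℝ] ℝ} (h : P.hamiltonian t x a q ≤ 0) :
    ∃ τ ∈ P.K, -a - q (P.f t x τ) - P.psi t x τ ≤ 0 := by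
  obtain ⟨τ, hτ, hmin⟩ := hP.isCompact_K.exists_isMinOn hP.nonempty_K
    (continuousOn_hamiltonian_integrand hP ht x a q)
  have := hP.nonempty_K.to_subtype
  exact ⟨τ, hτ, (le_ciInf fun σ : P.K => hmin σ.2).trans h⟩

theorem forall_of_hamiltonian_nonneg (hP : P.Standing) {t : ℝ} (ht : t ∈ Icc 0 P.T)
    {x : State m} {a : ℝ} {q : State m →L[ℝ] ℝ} (h : 0 ≤ P.hamiltonian t x a q) :
    ∀ τ ∈ P.K, 0 ≤ -a - q (P.f t x τ) - P.psi t x τ := by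
  intro τ hτ
  have hbdd : BddBelow (range fun τ : P.K => -a - q (P.f t x τ) - P.psi t x τ) := by
    have := (hP.isCompact_K.image_of_continuousOn
      (continuousOn_hamiltonian_integrand hP ht x a q)).bddBelow
    rwa [image_eq_range] at this
  exact h.trans (ciInf_le hbdd ⟨τ, hτ⟩)

theorem exists_jump_of_nonneg {t : ℝ} {x : State m} (h : 0 ≤ (v t x : EReal) - P.N v t x)
    {ε : ℝ} (hε : 0 < ε) :
    ∃ l ∈ P.jumps x, v t (P.stateAfter t x l) + P.costOf t x l < v t x + ε := by
  have h1 : P.N v t x ≤ v t x := by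
    refine EReal.sub_nonneg ?_ ?_ |>.1 h <;> simp
  have h2 : P.N v t x < ((v t x + ε : ℝ) : EReal) :=
    h1.trans_lt (EReal.coe_lt_coe_iff.2 (by linarith))
  obtain ⟨l, hl⟩ := iInf_lt_iff.1 h2
  obtain ⟨hl, h3⟩ := iInf_lt_iff.1 hl
  exact ⟨l, hl, EReal.coe_lt_coe_iff.1 h3⟩

end ImpulseProblem

/-! ### Viscosity inequalities for the exponential transform -/

/-- The exponential transform `exp (κ t + β - v)` of a function `v`. -/
noncomputable def expTransform {m : ℕ} (κ β : ℝ) (v : ℝ → State m → ℝ) (t : ℝ) (x : State m) : ℝ :=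
  Real.exp (κ * t + β - v t x)

theorem sq_quadAt_le {m : ℕ} (t : ℝ) (x : State m) (a : ℝ) (q : State m →L[ℝ] ℝ) (M s : ℝ)
    (y : State m) (h : (s - t) ^ 2 + ‖y - x‖ ^ 2 ≤ 1) :
    quadAt t x a q M s y ^ 2
      ≤ 3 * (a ^ 2 + ‖q‖ ^ 2 + M ^ 2) * ((s - t) ^ 2 + ‖y - x‖ ^ 2) := by
  unfold quadAt
  set n := (s - t) ^ 2 + ‖y - x‖ ^ 2 with hn
  have hn0 : 0 ≤ n := by positivity
  have h1 : (a * (s - t)) ^ 2 ≤ a ^ 2 * n := by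
    rw [mul_pow]; gcongr; rw [hn]; linarith [sq_nonneg ‖y - x‖]
  have h2 : (q (y - x)) ^ 2 ≤ ‖q‖ ^ 2 * n := by
    calc (q (y - x)) ^ 2 = ‖q (y - x)‖ ^ 2 := by rw [Real.norm_eq_abs, sq_abs]
      _ ≤ (‖q‖ * ‖y - x‖) ^ 2 := by gcongr; exact q.le_opNorm _
      _ = ‖q‖ ^ 2 * ‖y - x‖ ^ 2 := by ring
      _ ≤ ‖q‖ ^ 2 * n := by gcongr; rw [hn]; linarith [sq_nonneg (s - t)]
  have h3 : (M * n) ^ 2 ≤ M ^ 2 * n := by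
    rw [mul_pow]; gcongr; nlinarith
  nlinarith [sq_nonneg (a * (s - t) - q (y - x)), sq_nonneg (a * (s - t) - M * n),
    sq_nonneg (q (y - x) - M * n)]

/-- Apply `1 + u ≤ exp u` with `u = z + 2z²`, and note that `(1 - z)(1 + z + 2z²) = 1 + z²(1 - 2z) ≥
1`. -/
theorem exp_neg_add_two_mul_sq_le {z : ℝ} (hz : |z| ≤ 1 / 2) :
    Real.exp (-(z + 2 * z ^ 2)) ≤ 1 - z := by
  obtain ⟨h1, h2⟩ := abs_le.1 hz
  have h3 : 0 < 1 + (z + 2 * z ^ 2) := by nlinarith [sq_nonneg z]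
  rw [Real.exp_neg]
  refine (inv_anti₀ h3 (by linarith [Real.add_one_le_exp (z + 2 * z ^ 2)])).trans ?_
  rw [inv_le_iff_one_le_mul₀ h3]
  nlinarith [mul_nonneg (sq_nonneg z) (by linarith : 0 ≤ 1 - 2 * z)]

namespace ImpulseProblem

variable {m : ℕ} {P : ImpulseProblem m} {t₀ : ℝ} {v : ℝ → State m → ℝ}

/-- Taking logarithms of a quadratic bound on the transform bounds `v` by a quadratic up to a
second-order error, which only enlarges the coefficient `M`. The equation is then multiplied by the
value `w > 0`. -/
theorem IsViscositySubsolution.expTransform_le (hP : P.Standing) (ht₀ : 0 ≤ t₀)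
    (h : P.IsViscositySubsolution t₀ v) (κ β : ℝ) {t : ℝ} (ht : t ∈ Ico t₀ P.T) {x : State m}
    {a : ℝ} {q : State m →L[ℝ] ℝ} {M : ℝ}
    (hv : ∀ᶠ p in 𝓝[Ico t₀ P.T ×ˢ univ] (t, x),
      expTransform κ β v t x - quadAt t x a q M p.1 p.2 ≤ expTransform κ β v p.1 p.2) :
    ∃ τ ∈ P.K, -a - q (P.f t x τ) ≤ expTransform κ β v t x * (P.psi t x τ + κ) := by
  set w := expTransform κ β v t x with hw
  have hw0 : 0 < w := Real.exp_pos _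
  have hqvi : P.qvi v t x (κ + a / w) (w⁻¹ • q) ≤ 0 := by
    -- The term with factor `6` is twice the bound of `sq_quadAt_le`; it dominates the correction
    -- `2z²`.
    refine h.qvi_nonpos ht (M := M / w + 6 * (a ^ 2 + ‖q‖ ^ 2 + M ^ 2) / w ^ 2) ?_
    have hz : ∀ᶠ p in 𝓝 (t, x), |quadAt t x a q M p.1 p.2 / w| < 1 / 2 := by
      refine ContinuousAt.eventually_lt
        ((continuous_quadAt t x a q M).div_const w).abs.continuousAt continuousAt_const ?_
      simp [quadAt]
    have hn : ∀ᶠ p in 𝓝 (t, x), (p.1 - t) ^ 2 + ‖p.2 - x‖ ^ 2 < 1 := by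
      refine ContinuousAt.eventually_lt (Continuous.continuousAt (by fun_prop))
        continuousAt_const ?_
      simp
    filter_upwards [hv, mem_nhdsWithin_of_mem_nhds hz, mem_nhdsWithin_of_mem_nhds hn]
      with p h1 h2 h3
    set z := quadAt t x a q M p.1 p.2 / w with hzdef
    have h4 : w * Real.exp (-(z + 2 * z ^ 2)) ≤ expTransform κ β v p.1 p.2 := by
      refine le_trans ?_ h1
      have := mul_le_mul_of_nonneg_left (exp_neg_add_two_mul_sq_le h2.le) hw0.le
      have h5 : w * (1 - z) = w - quadAt t x a q M p.1 p.2 := by rw [hzdef]; field_simp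
      linarith
    rw [hw, expTransform, expTransform, ← Real.exp_add, Real.exp_le_exp] at h4
    have h6 : z ^ 2 ≤ 3 * (a ^ 2 + ‖q‖ ^ 2 + M ^ 2) * ((p.1 - t) ^ 2 + ‖p.2 - x‖ ^ 2) / w ^ 2 := by
      rw [hzdef, div_pow]
      gcongr
      exact sq_quadAt_le t x a q M p.1 p.2 h3.le
    have h7 : quadAt t x (κ + a / w) (w⁻¹ • q) (M / w + 6 * (a ^ 2 + ‖q‖ ^ 2 + M ^ 2) / w ^ 2)
        p.1 p.2 = κ * (p.1 - t) + z + 2 * (3 * (a ^ 2 + ‖q‖ ^ 2 + M ^ 2) *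
          ((p.1 - t) ^ 2 + ‖p.2 - x‖ ^ 2) / w ^ 2) := by
      rw [hzdef, quadAt, quadAt, smul_apply, smul_eq_mul]
      ring
    rw [h7]
    linarith
  have hham : P.hamiltonian t x (κ + a / w) (w⁻¹ • q) ≤ 0 :=
    EReal.coe_le_coe_iff.1 ((le_max_left _ _).trans hqvi)
  obtain ⟨τ, hτ, h1⟩ := exists_of_hamiltonian_nonpos hP ⟨ht₀.trans ht.1, ht.2.le⟩ hham
  refine ⟨τ, hτ, ?_⟩
  have h2 := mul_le_mul_of_nonneg_left h1 hw0.le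
  have h3 : w * (-(κ + a / w) - (w⁻¹ • q) (P.f t x τ) - P.psi t x τ)
      = -a - q (P.f t x τ) - w * (P.psi t x τ + κ) := by
    rw [smul_apply, smul_eq_mul]
    field_simp
    ring
  linarith

/-- Here `1 - z ≤ exp (-z)` goes the right way, so no second-order correction is needed. -/
theorem IsViscositySupersolution.le_expTransform (hP : P.Standing) (ht₀ : 0 ≤ t₀)
    (h : P.IsViscositySupersolution t₀ v) {κ β : ℝ}
    (hle : ∀ t ∈ Icc t₀ P.T, ∀ x, expTransform κ β v t x ≤ 1)
    {t : ℝ} (ht : t ∈ Ico t₀ P.T) {x : State m}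
    {a : ℝ} {q : State m →L[ℝ] ℝ} {M : ℝ}
    (hv : ∀ᶠ p in 𝓝[Ico t₀ P.T ×ˢ univ] (t, x),
      expTransform κ β v p.1 p.2 ≤ expTransform κ β v t x - quadAt t x a q M p.1 p.2) :
    (∀ τ ∈ P.K, expTransform κ β v t x * (P.psi t x τ + κ) ≤ -a - q (P.f t x τ)) ∨
      ∀ ε > 0, ∃ l ∈ P.jumps x, expTransform κ β v t x
        ≤ Real.exp (-P.costOf t x l) * expTransform κ β v t (P.stateAfter t x l) + ε := by
  set w := expTransform κ β v t x with hw
  have hw0 : 0 < w := Real.exp_pos _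
  have hqvi : 0 ≤ P.qvi v t x (κ + a / w) (w⁻¹ • q) := by
    refine h.qvi_nonneg ht (M := M / w) ?_
    filter_upwards [hv] with p h1
    set z := quadAt t x a q M p.1 p.2 / w with hzdef
    have h4 : expTransform κ β v p.1 p.2 ≤ w * Real.exp (-z) := by
      refine h1.trans ?_
      have := mul_le_mul_of_nonneg_left (Real.add_one_le_exp (-z)) hw0.le
      have h5 : w * (-z + 1) = w - quadAt t x a q M p.1 p.2 := by rw [hzdef]; field_simp; ring
      linarith
    rw [hw, expTransform, expTransform, ← Real.exp_add, Real.exp_le_exp] at h4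
    have h7 : quadAt t x (κ + a / w) (w⁻¹ • q) (M / w) p.1 p.2 = κ * (p.1 - t) + z := by
      rw [hzdef, quadAt, quadAt, smul_apply, smul_eq_mul]
      ring
    rw [h7]
    linarith
  rcases le_max_iff.1 hqvi with hham | hjump
  · left
    intro τ hτ
    have h1 := forall_of_hamiltonian_nonneg hP ⟨ht₀.trans ht.1, ht.2.le⟩
      (EReal.coe_le_coe_iff.1 hham) τ hτ
    have h2 := mul_nonneg hw0.le h1
    have h3 : w * (-(κ + a / w) - (w⁻¹ • q) (P.f t x τ) - P.psi t x τ)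
        = -a - q (P.f t x τ) - w * (P.psi t x τ + κ) := by
      rw [smul_apply, smul_eq_mul]
      field_simp
      ring
    linarith
  · right
    intro ε hε
    -- An error `log (1 + ε)` in `v` is a factor `1 + ε` in the transform, hence an additive error
    -- at most `ε`, as the transform is at most `1`.
    obtain ⟨l, hl, h1⟩ := exists_jump_of_nonneg hjump
      (Real.log_pos (by linarith : (1 : ℝ) < 1 + ε))
    refine ⟨l, hl, ?_⟩
    have h2 : w * (1 + ε)⁻¹
        ≤ Real.exp (-P.costOf t x l) * expTransform κ β v t (P.stateAfter t x l) := by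
      rw [← Real.exp_log (by linarith : (0 : ℝ) < 1 + ε), ← Real.exp_neg, hw, expTransform,
        expTransform, ← Real.exp_add, ← Real.exp_add, Real.exp_le_exp]
      linarith
    have h3 : w ≤ 1 := hle t (Ico_subset_Icc_self ht) x
    have h4 : w ≤ w * (1 + ε)⁻¹ + ε := by
      have h5 : w - w * (1 + ε)⁻¹ = w * ε / (1 + ε) := by field_simp; ring
      have h6 : w * ε / (1 + ε) ≤ ε := by
        rw [div_le_iff₀ (by linarith)]; nlinarith
      linarith
    linarith

theorem IsViscositySubsolution.jump_le_expTransform (hm : 0 < m) (hP : P.Standing) (ht₀ : 0 ≤ t₀)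
    (h : P.IsViscositySubsolution t₀ v) (κ β : ℝ) {t : ℝ} (ht : t ∈ Ico t₀ P.T) {x : State m}
    {l : List (State m)} (hl : l ∈ P.jumps x) :
    Real.exp (-P.costOf t x l) * expTransform κ β v t (P.stateAfter t x l)
      ≤ expTransform κ β v t x := by
  rw [expTransform, expTransform, ← Real.exp_add, Real.exp_le_exp]
  linarith [h.le_jump hm hP ht₀ ht hl]

theorem length_mul_le_costOf {α : ℝ} {t : ℝ} (hα : ∀ x ξ : State m, α ≤ P.cost t x ξ)
    (x : State m) (l : List (State m)) : l.length * α ≤ P.costOf t x l := by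
  induction l generalizing x with
  | nil => simp [costOf]
  | cons ξ l ih =>
    have := ih (x + P.g t x ξ)
    have := hα x ξ
    rw [costOf, List.length_cons]
    push_cast
    linarith

end ImpulseProblem

/-! ### The logarithmic penalty -/

/-- The penalty `log (1 + |x|²)`: it tends to infinity, its derivative along vector fields of
linear growth is bounded, and so is its increment along a jump of linear growth. -/
noncomputable def logPenalty {m : ℕ} (x : State m) : ℝ := Real.log (1 + ‖x‖ ^ 2)

section logPenalty

variable {m : ℕ}

theorem logPenalty_nonneg (x : State m) : 0 ≤ logPenalty x :=
  Real.log_nonneg (by linarith [sq_nonneg ‖x‖])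

theorem continuous_logPenalty : Continuous (logPenalty : State m → ℝ) := by
  unfold logPenalty
  exact Continuous.log (by fun_prop) (fun x => by positivity)

theorem norm_le_exp_logPenalty (x : State m) : ‖x‖ ≤ Real.exp (logPenalty x) := by
  rw [logPenalty, Real.exp_log (by positivity)]
  nlinarith [sq_nonneg (‖x‖ - 1)]

/-- By `log u ≤ u - 1` for the ratio of the arguments, the penalty lies below a paraboloid tangent
at `x`, so it can enter a quadratic test function. -/
theorem logPenalty_le (x y : State m) :
    logPenalty y ≤ logPenalty x + 2 / (1 + ‖x‖ ^ 2) * inner ℝ x (y - x) + ‖y - x‖ ^ 2 := by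
  have hx : 0 < 1 + ‖x‖ ^ 2 := by positivity
  have hy : 0 < 1 + ‖y‖ ^ 2 := by positivity
  have h1 : logPenalty y - logPenalty x ≤ (1 + ‖y‖ ^ 2) / (1 + ‖x‖ ^ 2) - 1 := by
    rw [logPenalty, logPenalty, ← Real.log_div hy.ne' hx.ne']
    exact Real.log_le_sub_one_of_pos (by positivity)
  have h2 : ‖y‖ ^ 2 = ‖x‖ ^ 2 + 2 * inner ℝ x (y - x) + ‖y - x‖ ^ 2 := by
    rw [← norm_add_sq_real]; congr 2; abel
  have h3 : (1 + ‖y‖ ^ 2) / (1 + ‖x‖ ^ 2) - 1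
      = 2 / (1 + ‖x‖ ^ 2) * inner ℝ x (y - x) + ‖y - x‖ ^ 2 / (1 + ‖x‖ ^ 2) := by
    rw [h2]; field_simp; ring
  have h4 : ‖y - x‖ ^ 2 / (1 + ‖x‖ ^ 2) ≤ ‖y - x‖ ^ 2 :=
    div_le_self (by positivity) (by linarith [sq_nonneg ‖x‖])
  linarith

theorem logPenalty_deriv_le {L : ℝ} {x w : State m} (hL : 0 ≤ L) (hw : ‖w‖ ≤ L * (1 + ‖x‖)) :
    2 / (1 + ‖x‖ ^ 2) * inner ℝ x w ≤ 4 * L := by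
  have h1 : inner ℝ x w ≤ ‖x‖ * (L * (1 + ‖x‖)) :=
    (real_inner_le_norm x w).trans (by gcongr)
  rw [div_mul_eq_mul_div, div_le_iff₀ (by positivity)]
  have h2 : ‖x‖ * (1 + ‖x‖) ≤ 2 * (1 + ‖x‖ ^ 2) := by nlinarith [sq_nonneg (‖x‖ - 1)]
  have h3 := mul_le_mul_of_nonneg_left h2 hL
  linarith

theorem logPenalty_add_le {L : ℝ} {x w : State m} (hw : ‖w‖ ≤ L * (1 + ‖x‖)) :
    logPenalty (x + w) ≤ logPenalty x + Real.log (2 + 4 * L ^ 2) := by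
  rw [logPenalty, logPenalty, ← Real.log_mul (by positivity) (by positivity)]
  refine Real.log_le_log (by positivity) ?_
  have h1 : ‖x + w‖ ^ 2 ≤ (‖x‖ + L * (1 + ‖x‖)) ^ 2 := by
    gcongr
    exact (norm_add_le _ _).trans (by linarith)
  nlinarith [sq_nonneg (‖x‖ - L * (1 + ‖x‖)), mul_nonneg (sq_nonneg L) (sq_nonneg (‖x‖ - 1))]

theorem ImpulseProblem.logPenalty_stateAfter_le {P : ImpulseProblem m} {L t : ℝ}
    (hL : ∀ x ξ : State m, ‖P.g t x ξ‖ ≤ L * (1 + ‖x‖)) (x : State m) (l : List (State m)) :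
    logPenalty (P.stateAfter t x l) ≤ logPenalty x + l.length * Real.log (2 + 4 * L ^ 2) := by
  induction l generalizing x with
  | nil => simp [stateAfter]
  | cons ξ l ih =>
    have := ih (x + P.g t x ξ)
    have := logPenalty_add_le (hL x ξ)
    rw [stateAfter, List.length_cons]
    push_cast
    linarith

end logPenalty

/-! ### Uniform continuity on bounded sets -/

theorem exists_modulus {m : ℕ} {E : Type*} [NormedAddCommGroup E] {t₀ T : ℝ} {K : Set (State m)}
    (hK : IsCompact K) {F : ℝ → State m → State m → E}
    (hF : ContinuousOn (fun p : ℝ × State m × State m => F p.1 p.2.1 p.2.2)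
      (Icc t₀ T ×ˢ (univ ×ˢ K))) (R : ℝ) {ε : ℝ} (hε : 0 < ε) :
    ∃ ρ > 0, ∀ t ∈ Icc t₀ T, ∀ s ∈ Icc t₀ T, ∀ x y : State m, ‖x‖ ≤ R → ‖y‖ ≤ R →
      |t - s| ≤ ρ → ‖x - y‖ ≤ ρ → ∀ τ ∈ K, ‖F t x τ - F s y τ‖ ≤ ε := by
  have hQ : IsCompact (Icc t₀ T ×ˢ (Metric.closedBall (0 : State m) R ×ˢ K)) :=
    isCompact_Icc.prod ((isCompact_closedBall _ _).prod hK)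
  have hu := hQ.uniformContinuousOn_of_continuous
    (hF.mono (prod_mono subset_rfl (prod_mono (subset_univ _) subset_rfl)))
  obtain ⟨ρ, hρ, h⟩ := Metric.uniformContinuousOn_iff_le.1 hu ε hε
  refine ⟨ρ, hρ, fun t ht s hs x y hx hy hts hxy τ hτ => ?_⟩
  have := h (t, x, τ) ⟨ht, by simpa using hx, hτ⟩ (s, y, τ) ⟨hs, by simpa using hy, hτ⟩ (by
    rw [Prod.dist_eq, Prod.dist_eq, dist_self, dist_eq_norm, dist_eq_norm, Real.norm_eq_abs]
    exact max_le hts (max_le hxy hρ.le))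
  rwa [dist_eq_norm] at this

theorem exists_modulus' {m : ℕ} {t₀ T : ℝ} {F : ℝ → State m → ℝ}
    (hF : ContinuousOn (fun p : ℝ × State m => F p.1 p.2) (Icc t₀ T ×ˢ univ))
    (R : ℝ) {ε : ℝ} (hε : 0 < ε) :
    ∃ ρ > 0, ∀ t ∈ Icc t₀ T, ∀ s ∈ Icc t₀ T, ∀ x y : State m, ‖x‖ ≤ R → ‖y‖ ≤ R →
      |t - s| ≤ ρ → ‖x - y‖ ≤ ρ → |F t x - F s y| ≤ ε := by
  obtain ⟨ρ, hρ, h⟩ := exists_modulus (K := {(0 : State m)}) isCompact_singleton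
    (F := fun t x _ => F t x) (t₀ := t₀) (T := T)
    (hF.comp (f := fun p : ℝ × State m × State m => (p.1, p.2.1)) (by fun_prop)
      (fun p hp => ⟨hp.1, mem_univ _⟩)) R hε
  exact ⟨ρ, hρ, fun t ht s hs x y hx hy hts hxy => h t ht s hs x y hx hy hts hxy 0 rfl⟩

/-! ### Doubling of variables -/

/-- The functional with doubled variables
`r(s,y) - p(t,x) - δ (log (1 + |x|²) + A (T - t)) - a |x - y|² - b (t - s)²`. -/
noncomputable def doubled {m : ℕ} (p r : ℝ → State m → ℝ) (T δ A a b : ℝ)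
    (z : (ℝ × State m) × (ℝ × State m)) : ℝ :=
  r z.2.1 z.2.2 - p z.1.1 z.1.2 - δ * (logPenalty z.1.2 + A * (T - z.1.1))
    - a * ‖z.1.2 - z.2.2‖ ^ 2 - b * (z.1.1 - z.2.1) ^ 2

section doubled

variable {m : ℕ} {p r : ℝ → State m → ℝ} {t₀ T δ A a b : ℝ}

/-- Since `r - p ≤ 1` and every penalty is nonnegative, each penalty is at most `1` where the
functional is nonnegative. -/
theorem doubled_bounds (hp : ∀ t ∈ Icc t₀ T, ∀ x, 0 ≤ p t x) (hr : ∀ t ∈ Icc t₀ T, ∀ x, r t x ≤ 1)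
    (hδ : 0 < δ) (hA : 0 ≤ A) (ha : 0 ≤ a) (hb : 0 ≤ b) {t s : ℝ} {x y : State m}
    (ht : t ∈ Icc t₀ T) (hs : s ∈ Icc t₀ T) (h : 0 ≤ doubled p r T δ A a b ((t, x), (s, y))) :
    ‖x‖ ≤ Real.exp (1 / δ) ∧ a * ‖x - y‖ ^ 2 ≤ 1 ∧ b * (t - s) ^ 2 ≤ 1 := by
  simp only [doubled] at h
  have h1 := hp t ht x
  have h2 := hr s hs y
  have h3 : 0 ≤ δ * logPenalty x := mul_nonneg hδ.le (logPenalty_nonneg x)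
  have h4 : 0 ≤ δ * (A * (T - t)) :=
    mul_nonneg hδ.le (mul_nonneg hA (by linarith [ht.2]))
  have h5 : 0 ≤ a * ‖x - y‖ ^ 2 := by positivity
  have h6 : 0 ≤ b * (t - s) ^ 2 := by positivity
  refine ⟨?_, by linarith, by linarith⟩
  refine (norm_le_exp_logPenalty x).trans (Real.exp_le_exp.2 ?_)
  rw [le_div_iff₀ hδ]
  linarith

/-- The set where the functional is nonnegative lies in a compact set: `x` is bounded through the
logarithm, and `y` through `a ≥ 1`. -/
theorem exists_max_doubled
    (hpc : ContinuousOn (fun z : ℝ × State m => p z.1 z.2) (Icc t₀ T ×ˢ univ))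
    (hrc : ContinuousOn (fun z : ℝ × State m => r z.1 z.2) (Icc t₀ T ×ˢ univ))
    (hp : ∀ t ∈ Icc t₀ T, ∀ x, 0 ≤ p t x) (hr : ∀ t ∈ Icc t₀ T, ∀ x, r t x ≤ 1)
    (hδ : 0 < δ) (hA : 0 ≤ A) (ha : 1 ≤ a) (hb : 0 ≤ b)
    {t' : ℝ} (ht' : t' ∈ Icc t₀ T) {x' : State m}
    (h : 0 ≤ doubled p r T δ A a b ((t', x'), (t', x'))) :
    ∃ t ∈ Icc t₀ T, ∃ x : State m, ∃ s ∈ Icc t₀ T, ∃ y : State m,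
      ∀ t₁ ∈ Icc t₀ T, ∀ x₁ : State m, ∀ s₁ ∈ Icc t₀ T, ∀ y₁ : State m,
        doubled p r T δ A a b ((t₁, x₁), (s₁, y₁)) ≤ doubled p r T δ A a b ((t, x), (s, y)) := by
  set B := Metric.closedBall (0 : State m) (Real.exp (1 / δ) + 1) with hB
  set Q := (Icc t₀ T ×ˢ B) ×ˢ (Icc t₀ T ×ˢ B) with hQ
  have hQc : IsCompact Q := (isCompact_Icc.prod (isCompact_closedBall _ _)).prod
    (isCompact_Icc.prod (isCompact_closedBall _ _))
  have hmem : ∀ t₁ ∈ Icc t₀ T, ∀ x₁ : State m, ∀ s₁ ∈ Icc t₀ T, ∀ y₁ : State m,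
      0 ≤ doubled p r T δ A a b ((t₁, x₁), (s₁, y₁)) → ((t₁, x₁), (s₁, y₁)) ∈ Q := by
    intro t₁ ht₁ x₁ s₁ hs₁ y₁ h0
    obtain ⟨h1, h2, -⟩ := doubled_bounds hp hr hδ hA (by linarith) hb ht₁ hs₁ h0
    have h3 : ‖x₁ - y₁‖ ≤ 1 := by
      have : ‖x₁ - y₁‖ ^ 2 ≤ 1 := by nlinarith [sq_nonneg ‖x₁ - y₁‖]
      exact (sq_le_one_iff₀ (norm_nonneg _)).1 this
    have h4 : ‖y₁‖ ≤ ‖x₁‖ + ‖x₁ - y₁‖ := by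
      have := norm_sub_le x₁ (x₁ - y₁)
      rwa [sub_sub_cancel] at this
    refine ⟨⟨ht₁, ?_⟩, hs₁, ?_⟩ <;> rw [hB, mem_closedBall_zero_iff] <;> linarith
  have hcont : ContinuousOn (doubled p r T δ A a b) Q := by
    have h1 : ContinuousOn (fun z : (ℝ × State m) × (ℝ × State m) => p z.1.1 z.1.2) Q :=
      hpc.comp (f := Prod.fst) continuousOn_fst (fun z hz => ⟨hz.1.1, mem_univ _⟩)
    have h2 : ContinuousOn (fun z : (ℝ × State m) × (ℝ × State m) => r z.2.1 z.2.2) Q :=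
      hrc.comp (f := Prod.snd) continuousOn_snd (fun z hz => ⟨hz.2.1, mem_univ _⟩)
    have h3 : Continuous (fun z : (ℝ × State m) × (ℝ × State m) => logPenalty z.1.2) :=
      continuous_logPenalty.comp (by fun_prop)
    exact (((h2.sub h1).sub (by fun_prop)).sub (by fun_prop)).sub (by fun_prop)
  obtain ⟨⟨⟨t, x⟩, s, y⟩, hz, hmax⟩ := hQc.exists_isMaxOn ⟨_, hmem t' ht' x' t' ht' x' h⟩ hcont
  refine ⟨t, hz.1.1, x, s, hz.2.1, y, fun t₁ ht₁ x₁ s₁ hs₁ y₁ => ?_⟩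
  rcases le_total 0 (doubled p r T δ A a b ((t₁, x₁), (s₁, y₁))) with h0 | h0
  · exact hmax (hmem t₁ ht₁ x₁ s₁ hs₁ y₁ h0)
  · exact h0.trans (h.trans (hmax (hmem t' ht' x' t' ht' x' h)))

/-- At a maximum of the doubled functional, `p` is touched from below. -/
theorem quadAt_le_of_max_doubled (hδ : 0 ≤ δ) (ha : 0 ≤ a) (hb : 0 ≤ b) {t s t₁ : ℝ}
    {x y x₁ : State m}
    (h : doubled p r T δ A a b ((t₁, x₁), (s, y)) ≤ doubled p r T δ A a b ((t, x), (s, y))) :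
    p t x - quadAt t x (2 * b * (t - s) - δ * A)
      ((δ * (2 / (1 + ‖x‖ ^ 2))) • (innerSL ℝ x : State m →L[ℝ] ℝ)
        + (2 * a) • (innerSL ℝ (x - y) : State m →L[ℝ] ℝ)) (δ + a + b) t₁ x₁ ≤ p t₁ x₁ := by
  simp only [doubled] at h
  have h1 : ‖x₁ - y‖ ^ 2 = ‖x - y‖ ^ 2 + 2 * inner ℝ (x - y) (x₁ - x) + ‖x₁ - x‖ ^ 2 := by
    rw [← norm_add_sq_real]; congr 2; abel
  have h2 := mul_le_mul_of_nonneg_left (logPenalty_le x x₁) hδ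
  have h3 : ((δ * (2 / (1 + ‖x‖ ^ 2))) • (innerSL ℝ x : State m →L[ℝ] ℝ)
      + (2 * a) • (innerSL ℝ (x - y) : State m →L[ℝ] ℝ)) (x₁ - x)
      = δ * (2 / (1 + ‖x‖ ^ 2) * inner ℝ x (x₁ - x)) + 2 * a * inner ℝ (x - y) (x₁ - x) := by
    rw [add_apply, smul_apply,
      smul_apply, innerSL_apply_apply, innerSL_apply_apply, smul_eq_mul,
      smul_eq_mul, mul_assoc]
  rw [quadAt, h3]
  rw [h1] at h
  have h4 : 0 ≤ b * ‖x₁ - x‖ ^ 2 := by positivity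
  have h5 : 0 ≤ (δ + a) * (t₁ - t) ^ 2 := by positivity
  nlinarith

/-- At a maximum of the doubled functional, `r` is touched from above. -/
theorem le_quadAt_of_max_doubled (ha : 0 ≤ a) (hb : 0 ≤ b) {t s s₁ : ℝ} {x y y₁ : State m}
    (h : doubled p r T δ A a b ((t, x), (s₁, y₁)) ≤ doubled p r T δ A a b ((t, x), (s, y))) :
    r s₁ y₁ ≤ r s y - quadAt s y (2 * b * (t - s))
      ((2 * a) • (innerSL ℝ (x - y) : State m →L[ℝ] ℝ)) (-(a + b)) s₁ y₁ := by
  simp only [doubled] at h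
  have h1 : ‖x - y₁‖ ^ 2 = ‖x - y‖ ^ 2 - 2 * inner ℝ (x - y) (y₁ - y) + ‖y₁ - y‖ ^ 2 := by
    rw [← norm_sub_sq_real]; congr 2; abel
  have h3 : ((2 * a) • (innerSL ℝ (x - y) : State m →L[ℝ] ℝ)) (y₁ - y)
      = 2 * a * inner ℝ (x - y) (y₁ - y) := by
    rw [smul_apply, innerSL_apply_apply, smul_eq_mul]
  rw [quadAt, h3]
  rw [h1] at h
  have h4 : 0 ≤ b * ‖y₁ - y‖ ^ 2 := by positivity
  have h5 : 0 ≤ a * (s₁ - s) ^ 2 := by positivity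
  nlinarith

end doubled

/-! ### The two contradictions and the comparison principle -/

/-- The inequality between the derivatives of the penalty that the two viscosity inequalities
imply. -/
theorem penalty_le_of_viscosity {m : ℕ} {L A a b δ p r ψ ψ' t s : ℝ} {x y w w' : State m}
    (hL : 0 ≤ L) (hA : A = 4 * L + 1) (ha : 0 ≤ a) (hδ : 0 ≤ δ)
    (hw : ‖w‖ ≤ L * (1 + ‖x‖)) (hp0 : 0 ≤ p) (hp : p ≤ 1) (hpr : p ≤ r) (hψ' : 0 ≤ ψ')
    (hsub : -(2 * b * (t - s) - δ * A)
      - ((δ * (2 / (1 + ‖x‖ ^ 2))) • (innerSL ℝ x : State m →L[ℝ] ℝ)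
        + (2 * a) • (innerSL ℝ (x - y) : State m →L[ℝ] ℝ)) w ≤ p * ψ)
    (hsuper : r * ψ' ≤ -(2 * b * (t - s))
      - ((2 * a) • (innerSL ℝ (x - y) : State m →L[ℝ] ℝ)) w') :
    δ ≤ 2 * a * (‖x - y‖ * ‖w - w'‖) + |ψ - ψ'| := by
  rw [add_apply, smul_apply,
    smul_apply, innerSL_apply_apply, innerSL_apply_apply, smul_eq_mul,
    smul_eq_mul, mul_assoc δ] at hsub
  rw [smul_apply, innerSL_apply_apply, smul_eq_mul] at hsuper
  have h1 := mul_le_mul_of_nonneg_left (logPenalty_deriv_le hL hw) hδ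
  have h2 : inner ℝ (x - y) w - inner ℝ (x - y) w' ≤ ‖x - y‖ * ‖w - w'‖ := by
    rw [← inner_sub_right]; exact real_inner_le_norm _ _
  have h3 := mul_le_mul_of_nonneg_left h2 (by linarith : 0 ≤ 2 * a)
  have h4 : p * ψ - r * ψ' ≤ |ψ - ψ'| := by
    -- Write `pψ - rψ' = p(ψ - ψ') - (r - p)ψ'`; the last term has a favourable sign because `ψ' ≥
    -- 0`.
    have h5 : p * (ψ - ψ') ≤ 1 * |ψ - ψ'| :=
      (mul_le_mul_of_nonneg_left (le_abs_self _) hp0).trans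
        (mul_le_mul_of_nonneg_right hp (abs_nonneg _))
    nlinarith [mul_nonneg (sub_nonneg.2 hpr) hψ']
  rw [hA] at hsub
  linarith

/-- Inserting `h2` into `h1` and using `n exp (-C) ≤ 1/α` gives `(1 - exp (-α)) D ≤ 4ε + δΛ/α`, at
most three quarters of `(1 - exp (-α)) θ`. -/
theorem jump_contraction_absurd {C α Λ δ ε D D' θ : ℝ} {n : ℕ} (hα : 0 < α) (hn : 1 ≤ n)
    (hC : n * α ≤ C) (hΛ : 0 ≤ Λ) (hδ : 0 ≤ δ) (hε : 0 ≤ ε) (hθ : 0 < θ)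
    (hδθ : δ * Λ / α ≤ (1 - Real.exp (-α)) * θ / 4) (hεθ : ε ≤ (1 - Real.exp (-α)) * θ / 8)
    (hθD : θ ≤ D) (h1 : D ≤ Real.exp (-C) * D' + ε) (h2 : D' ≤ D + 3 * ε + δ * (n * Λ)) :
    False := by
  have hαC : α ≤ C := by
    refine le_trans ?_ hC
    exact le_mul_of_one_le_left hα.le (by exact_mod_cast hn)
  have he : Real.exp (-C) ≤ Real.exp (-α) := Real.exp_le_exp.2 (by linarith)
  have he1 : Real.exp (-α) < 1 := Real.exp_lt_one_iff.2 (by linarith)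
  have hen : Real.exp (-C) * n ≤ 1 / α := by
    rw [le_div_iff₀ hα, Real.exp_neg, mul_assoc, inv_mul_le_iff₀ (Real.exp_pos C)]
    linarith [Real.add_one_le_exp C]
  have h3 : Real.exp (-C) * D' ≤ Real.exp (-C) * (D + 3 * ε + δ * (n * Λ)) :=
    mul_le_mul_of_nonneg_left h2 (Real.exp_pos _).le
  have h4 : Real.exp (-C) * n * (δ * Λ) ≤ 1 / α * (δ * Λ) :=
    mul_le_mul_of_nonneg_right hen (mul_nonneg hδ hΛ)
  have h5 : 1 / α * (δ * Λ) = δ * Λ / α := by ring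
  have h6 : Real.exp (-C) * ε ≤ 1 * ε :=
    mul_le_mul_of_nonneg_right (he.trans he1.le) hε
  have h7 : Real.exp (-C) * D ≤ Real.exp (-α) * D :=
    mul_le_mul_of_nonneg_right he (hθ.le.trans hθD)
  have h8 : (1 - Real.exp (-α)) * θ ≤ (1 - Real.exp (-α)) * D :=
    mul_le_mul_of_nonneg_left hθD (by linarith)
  have h9 : 0 < (1 - Real.exp (-α)) * θ := mul_pos (by linarith) hθ
  nlinarith

namespace ImpulseProblem

variable {m : ℕ} {P : ImpulseProblem m}

set_option maxHeartbeats 1000000 in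
/-- Comparison of exponential transforms: `p` is the transform of a subsolution and `r` that of a
supersolution. -/
theorem expTransform_comparison (hP : P.Standing) {t₀ κ : ℝ} (ht₀ : 0 ≤ t₀)
    (hκ : ∀ t ∈ Icc 0 P.T, ∀ x, ∀ τ ∈ P.K, 0 ≤ P.psi t x τ + κ) {p r : ℝ → State m → ℝ}
    (hpc : ContinuousOn (fun z : ℝ × State m => p z.1 z.2) (Icc t₀ P.T ×ˢ univ))
    (hrc : ContinuousOn (fun z : ℝ × State m => r z.1 z.2) (Icc t₀ P.T ×ˢ univ))
    (hp0 : ∀ t ∈ Icc t₀ P.T, ∀ x, 0 ≤ p t x) (hp1 : ∀ t ∈ Icc t₀ P.T, ∀ x, p t x ≤ 1)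
    (hr1 : ∀ t ∈ Icc t₀ P.T, ∀ x, r t x ≤ 1) (hT : ∀ x, r P.T x = p P.T x)
    (hsub : ∀ t ∈ Ico t₀ P.T, ∀ (x : State m) (a : ℝ) (q : State m →L[ℝ] ℝ) (M : ℝ),
      (∀ᶠ z in 𝓝[Ico t₀ P.T ×ˢ univ] (t, x), p t x - quadAt t x a q M z.1 z.2 ≤ p z.1 z.2) →
      ∃ τ ∈ P.K, -a - q (P.f t x τ) ≤ p t x * (P.psi t x τ + κ))
    (hsuper : ∀ t ∈ Ico t₀ P.T, ∀ (x : State m) (a : ℝ) (q : State m →L[ℝ] ℝ) (M : ℝ),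
      (∀ᶠ z in 𝓝[Ico t₀ P.T ×ˢ univ] (t, x), r z.1 z.2 ≤ r t x - quadAt t x a q M z.1 z.2) →
      (∀ τ ∈ P.K, r t x * (P.psi t x τ + κ) ≤ -a - q (P.f t x τ)) ∨
      ∀ ε > 0, ∃ l ∈ P.jumps x,
        r t x ≤ Real.exp (-P.costOf t x l) * r t (P.stateAfter t x l) + ε)
    (hjump : ∀ t ∈ Ico t₀ P.T, ∀ (x : State m), ∀ l ∈ P.jumps x,
      Real.exp (-P.costOf t x l) * p t (P.stateAfter t x l) ≤ p t x) :
    ∀ t ∈ Icc t₀ P.T, ∀ x, r t x ≤ p t x := by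
  intro t' ht' x'
  by_contra! hlt
  obtain ⟨L, hL0, hL⟩ := hP.growth_lipschitz_f_g
  obtain ⟨α, hα, hcost⟩ := hP.cost_ge
  have hIcc : Icc t₀ P.T ⊆ Icc 0 P.T := Icc_subset_Icc_left ht₀
  set θ : ℝ := (r t' x' - p t' x') / 3 with hθdef
  have hθ : 0 < θ := by rw [hθdef]; linarith
  set σ : ℝ := (1 - Real.exp (-α)) * θ with hσdef
  have hσ : 0 < σ := mul_pos (by linarith [Real.exp_lt_one_iff.2 (neg_lt_zero.2 hα)]) hθ
  -- The drift raises the penalty at rate at most `4L`; the extra `1` leaves the margin `δ`.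
  set A : ℝ := 4 * L + 1 with hA
  have hA0 : 0 < A := by linarith
  set Λ : ℝ := Real.log (2 + 4 * L ^ 2) with hΛdef
  have hΛ : 0 ≤ Λ := Real.log_nonneg (by nlinarith [sq_nonneg L])
  set c : ℝ := logPenalty x' + A * (P.T - t') with hc
  have hc0 : 0 ≤ c :=
    add_nonneg (logPenalty_nonneg _) (mul_nonneg hA0.le (by linarith [ht'.2]))
  obtain ⟨δ, hδ, hδ1, hδc, hδΛ⟩ : ∃ δ > 0, δ ≤ 1 ∧ δ * c ≤ θ ∧ δ * Λ / α ≤ σ / 4 := by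
    refine ⟨min 1 (min (θ / (c + 1)) (σ * α / (4 * (Λ + 1)))), by positivity, min_le_left _ _,
      ?_, ?_⟩
    · refine (mul_le_mul_of_nonneg_right
        ((min_le_right _ _).trans (min_le_left _ _)) hc0).trans ?_
      rw [div_mul_eq_mul_div, div_le_iff₀ (by positivity)]
      nlinarith
    · rw [div_le_iff₀ hα]
      refine (mul_le_mul_of_nonneg_right
        ((min_le_right _ _).trans (min_le_right _ _)) hΛ).trans ?_
      rw [div_mul_eq_mul_div, div_le_iff₀ (by positivity)]
      nlinarith [mul_pos hσ hα]
  obtain ⟨ε, hε, hεθ, hεσ, hεδ, hεL⟩ :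
      ∃ ε > 0, ε ≤ θ ∧ ε ≤ σ / 8 ∧ ε ≤ δ / 8 ∧ 2 * L * ε ≤ δ / 4 := by
    refine ⟨min θ (min (σ / 8) (δ / (8 * (L + 1)))), by positivity, min_le_left _ _,
      (min_le_right _ _).trans (min_le_left _ _), ?_, ?_⟩
    · refine ((min_le_right _ _).trans (min_le_right _ _)).trans ?_
      exact div_le_div_of_nonneg_left hδ.le (by norm_num) (by linarith)
    · refine (mul_le_mul_of_nonneg_left ((min_le_right _ _).trans (min_le_right _ _))
        (by linarith)).trans ?_
      rw [mul_div_assoc', div_le_iff₀ (by positivity)]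
      nlinarith
  set R : ℝ := Real.exp (1 / δ) + 1 with hR
  obtain ⟨ρ₁, hρ₁, hmp⟩ := exists_modulus' hpc R hε
  obtain ⟨ρ₂, hρ₂, hmr⟩ := exists_modulus' hrc R hε
  obtain ⟨ρ₃, hρ₃, hmχ⟩ := exists_modulus' (F := fun _ x => logPenalty x) (t₀ := t₀) (T := P.T)
    (continuous_logPenalty.comp continuous_snd).continuousOn R hε
  obtain ⟨ρ₄, hρ₄, hmψ⟩ := exists_modulus hP.isCompact_K (F := P.psi)
    (hP.continuousOn_psi.mono (prod_mono hIcc subset_rfl)) R hε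
  obtain ⟨ρ, hρ, hle1, hleA, hle₁, hle₂, hle₃, hle₄⟩ : ∃ ρ > 0, ρ ≤ 1 ∧ A * ρ ≤ ε ∧ ρ ≤ ρ₁ ∧
      ρ ≤ ρ₂ ∧ ρ ≤ ρ₃ ∧ ρ ≤ ρ₄ := by
    refine ⟨min 1 (min (ε / A) (min ρ₁ (min ρ₂ (min ρ₃ ρ₄)))), by positivity, by simp, ?_,
      by simp, by simp, by simp, by simp⟩
    have : min 1 (min (ε / A) (min ρ₁ (min ρ₂ (min ρ₃ ρ₄)))) ≤ ε / A := by simp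
    rwa [le_div_iff₀ hA0, mul_comm] at this
  set a : ℝ := 1 + 1 / ρ ^ 2 with ha
  have ha1 : 1 ≤ a := by rw [ha]; linarith [show 0 < 1 / ρ ^ 2 by positivity]
  have haρ : 1 ≤ a * ρ ^ 2 := by
    rw [ha, add_mul, one_div_mul_cancel (by positivity)]; nlinarith
  -- The variation of `f` in time is multiplied by `2a`, so its modulus, and with it `b`, must be
  -- chosen after `a`.
  obtain ⟨ρ₅, hρ₅, hmf⟩ := exists_modulus hP.isCompact_K (F := P.f)
    (hP.continuousOn_f.mono (prod_mono hIcc subset_rfl)) R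
    (show 0 < δ / (8 * a) by positivity)
  set ρ' : ℝ := min ρ ρ₅ with hρ'def
  have hρ' : 0 < ρ' := lt_min hρ hρ₅
  set b : ℝ := 1 / ρ' ^ 2 with hb
  have hb0 : 0 ≤ b := by positivity
  have hbρ : b * ρ' ^ 2 = 1 := one_div_mul_cancel (by positivity)
  have hstart : 2 * θ ≤ doubled p r P.T δ A a b ((t', x'), (t', x')) := by
    simp only [doubled, sub_self, norm_zero]
    linarith
  obtain ⟨t, ht, x, s, hs, y, hmax⟩ := exists_max_doubled hpc hrc hp0 hr1 hδ hA0.le ha1 hb0 ht'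
    (by linarith : 0 ≤ doubled p r P.T δ A a b ((t', x'), (t', x')))
  have hbig := hstart.trans (hmax t' ht' x' t' ht' x')
  obtain ⟨hx, hax, hbt⟩ := doubled_bounds hp0 hr1 hδ hA0.le (by linarith) hb0 ht hs
    (by linarith : 0 ≤ doubled p r P.T δ A a b ((t, x), (s, y)))
  have hxy : ‖x - y‖ ≤ ρ := by
    refine le_of_sq_le_sq ?_ hρ.le
    exact le_of_mul_le_mul_left (hax.trans haρ) (by linarith)
  have hts' : |t - s| ≤ ρ' := by
    refine le_of_sq_le_sq ?_ hρ'.le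
    rw [sq_abs]
    exact le_of_mul_le_mul_left (hbt.trans hbρ.ge) (by positivity)
  have hts : |t - s| ≤ ρ := hts'.trans (min_le_left _ _)
  have hxR : ‖x‖ ≤ R := by linarith
  have hyR : ‖y‖ ≤ R := by
    have := norm_sub_le x (x - y)
    rw [sub_sub_cancel] at this
    linarith
  have hχ0 : 0 ≤ δ * (logPenalty x + A * (P.T - t)) := mul_nonneg hδ.le
    (add_nonneg (logPenalty_nonneg _) (mul_nonneg hA0.le (by linarith [ht.2])))
  have hpen1 : 0 ≤ a * ‖x - y‖ ^ 2 := by positivity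
  have hpen2 : 0 ≤ b * (t - s) ^ 2 := by positivity
  have hgap : 2 * θ ≤ r s y - p t x := by
    simp only [doubled] at hbig
    linarith
  have hp_near := abs_le.1 (hmp t ht s hs x y hxR hyR (hts.trans hle₁) (hxy.trans hle₁))
  have hr_near := abs_le.1 (hmr t ht s hs x y hxR hyR (hts.trans hle₂) (hxy.trans hle₂))
  have hχ_near := abs_le.1 (hmχ t ht s hs x y hxR hyR (hts.trans hle₃) (hxy.trans hle₃))
  -- At the terminal time `r = p`, so the gap `2θ` would be at most a modulus error `ε ≤ θ`.
  have hsT : s < P.T := by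
    refine lt_of_le_of_ne hs.2 ?_
    rintro rfl
    have := hT y
    linarith
  have htT : t < P.T := by
    refine lt_of_le_of_ne ht.2 ?_
    rintro rfl
    have := hT x
    linarith
  -- Comparison with the diagonal point at `(t,x)` improves the bound `1` on this penalty to the
  -- modulus of `r`.
  have hsq : a * ‖x - y‖ ^ 2 ≤ ε := by
    have := hmax t ht x t ht x
    simp only [doubled, sub_self, norm_zero] at this
    linarith
  obtain ⟨τ, hτ, hτsub⟩ := hsub t ⟨ht.1, htT⟩ x _ _ _ (by
    filter_upwards [self_mem_nhdsWithin] with z hz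
    exact quadAt_le_of_max_doubled hδ.le (by linarith) hb0
      (hmax z.1 (Ico_subset_Icc_self hz.1) z.2 s hs y))
  rcases hsuper s ⟨hs.1, hsT⟩ y _ _ _ (by
    filter_upwards [self_mem_nhdsWithin] with z hz
    exact le_quadAt_of_max_doubled (by linarith) hb0
      (hmax t ht x z.1 (Ico_subset_Icc_self hz.1) z.2)) with h | h
  -- The control `τ` from the subsolution is used in both inequalities. The errors sum to at most
  -- `δ/4 + δ/4 + δ/8 < δ`.
  · have hLip := (hL t (hIcc ht) τ hτ 0 x y)
    have hkey := penalty_le_of_viscosity hL0 hA (by linarith) hδ.le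
      ((le_add_of_nonneg_right (norm_nonneg _)).trans hLip.1) (hp0 t ht x) (hp1 t ht x)
      (by linarith) (hκ s (hIcc hs) y τ hτ) hτsub (h τ hτ)
    have h1 : ‖P.f t x τ - P.f s y τ‖ ≤ L * ‖x - y‖ + δ / (8 * a) := by
      have h2 := hmf t ht s hs y y hyR hyR (hts'.trans (min_le_right _ _))
        (by simpa using hρ₅.le) τ hτ
      have h3 : ‖P.f t x τ - P.f t y τ‖ ≤ L * ‖x - y‖ := by
        linarith [hLip.2, norm_nonneg (P.g t x 0 - P.g t y 0)]
      linarith [norm_sub_le_norm_sub_add_norm_sub (P.f t x τ) (P.f t y τ) (P.f s y τ)]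
    have h2 : |P.psi t x τ + κ - (P.psi s y τ + κ)| ≤ ε := by
      rw [add_sub_add_right_eq_sub]
      exact hmψ t ht s hs x y hxR hyR (hts.trans hle₄) (hxy.trans hle₄) τ hτ
    have h3 : 2 * a * (‖x - y‖ * ‖P.f t x τ - P.f s y τ‖)
        ≤ 2 * a * (‖x - y‖ * (L * ‖x - y‖ + δ / (8 * a))) := by gcongr
    have h4 : 2 * a * (‖x - y‖ * (L * ‖x - y‖ + δ / (8 * a)))
        = 2 * L * (a * ‖x - y‖ ^ 2) + ‖x - y‖ * (δ / 4) := by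
      field_simp
      ring
    have h5 : ‖x - y‖ * (δ / 4) ≤ 1 * (δ / 4) := by
      gcongr
      exact hxy.trans hle1
    have h6 : 2 * L * (a * ‖x - y‖ ^ 2) ≤ 2 * L * ε := by gcongr
    linarith
  · obtain ⟨l, hl, hr⟩ := h ε hε
    have hpl := hjump s ⟨hs.1, hsT⟩ y l hl
    have hC := length_mul_le_costOf (P := P) (hcost s (hIcc hs)) y l
    have hn : 1 ≤ l.length := List.length_pos_iff.2 hl.1
    have hχl := logPenalty_stateAfter_le (P := P) (L := L) (t := s) (fun z ξ =>
      (le_add_of_nonneg_left (norm_nonneg _)).trans (hL s (hIcc hs) τ hτ ξ z z).1) y l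
    set y' := P.stateAfter s y l
    -- Both variables make the same jump from `(s,y)`. Replacing `(t,x)` by `(s,y)` costs three
    -- errors `ε`: in `p`, in the logarithm and in the time penalty.
    have hcomp := hmax s hs y' s hs y'
    simp only [doubled, sub_self, norm_zero] at hcomp
    refine jump_contraction_absurd (D := r s y - p s y) (D' := r s y' - p s y') hα hn hC hΛ hδ.le
      hε.le hθ hδΛ hεσ (by linarith) (by linarith) ?_
    have h1 : δ * logPenalty y' ≤ δ * (logPenalty y + l.length * Λ) := by gcongr
    have h2 : δ * (logPenalty y - logPenalty x) ≤ 1 * ε :=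
      (mul_le_mul_of_nonneg_left (by linarith) hδ.le).trans
        (mul_le_mul_of_nonneg_right hδ1 hε.le)
    have h3 : δ * (A * (t - s)) ≤ 1 * ε := by
      refine (mul_le_mul_of_nonneg_left (b := A * (t - s)) (c := ε) ?_ hδ.le).trans
        (mul_le_mul_of_nonneg_right hδ1 hε.le)
      exact (mul_le_mul_of_nonneg_left ((le_abs_self _).trans hts) hA0.le).trans hleA
    linarith

/-- A subsolution lies below a supersolution, if both are bounded from below. -/
theorem IsViscositySubsolution.le (hm : 0 < m) (hP : P.Standing) {t₀ : ℝ} (ht₀ : 0 ≤ t₀)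
    {u v : ℝ → State m → ℝ} (hu : P.IsViscositySubsolution t₀ u)
    (hv : P.IsViscositySupersolution t₀ v)
    (hub : ∃ b : ℝ, ∀ t ∈ Icc t₀ P.T, ∀ x : State m, b ≤ u t x)
    (hvb : ∃ b : ℝ, ∀ t ∈ Icc t₀ P.T, ∀ x : State m, b ≤ v t x) :
    ∀ t ∈ Icc t₀ P.T, ∀ x, u t x ≤ v t x := by
  obtain ⟨b₁, hb₁⟩ := hub
  obtain ⟨b₂, hb₂⟩ := hvb
  obtain ⟨b, hb⟩ := hP.psi_ge
  set κ := |b|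
  -- This makes the exponents nonpositive up to time `T`, so both transforms are at most `1`.
  set β := -κ * P.T + min b₁ b₂ with hβ
  have hbound : ∀ t ∈ Icc t₀ P.T, κ * t + β ≤ min b₁ b₂ := fun t ht => by
    have := mul_le_mul_of_nonneg_left ht.2 (abs_nonneg b : 0 ≤ κ)
    rw [hβ]; linarith
  have hu1 : ∀ t ∈ Icc t₀ P.T, ∀ x, expTransform κ β u t x ≤ 1 := fun t ht x => by
    rw [expTransform, Real.exp_le_one_iff]
    linarith [hbound t ht, min_le_left b₁ b₂, hb₁ t ht x]
  have hv1 : ∀ t ∈ Icc t₀ P.T, ∀ x, expTransform κ β v t x ≤ 1 := fun t ht x => by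
    rw [expTransform, Real.exp_le_one_iff]
    linarith [hbound t ht, min_le_right b₁ b₂, hb₂ t ht x]
  have hcont : ∀ w : ℝ → State m → ℝ, P.IsCandidate t₀ w →
      ContinuousOn (fun z : ℝ × State m => expTransform κ β w z.1 z.2) (Icc t₀ P.T ×ˢ univ) :=
    fun w hw => Real.continuous_exp.comp_continuousOn (ContinuousOn.sub (by fun_prop) hw.1)
  have hκ : ∀ t ∈ Icc 0 P.T, ∀ x, ∀ τ ∈ P.K, 0 ≤ P.psi t x τ + κ := fun t ht x τ hτ => by
    linarith [hb t ht x τ hτ, neg_abs_le b]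
  have hT : ∀ x, v P.T x = u P.T x := fun x =>
    EReal.coe_injective ((hv.1.2 x).trans (hu.1.2 x).symm)
  intro t ht x
  have := expTransform_comparison hP ht₀ hκ (hcont u hu.1) (hcont v hv.1)
    (fun _ _ _ => (Real.exp_pos _).le) hu1 hv1
    (fun x => by rw [expTransform, expTransform, hT])
    (fun t ht x a q M h => hu.expTransform_le hP ht₀ κ β ht h)
    (fun t ht x a q M h => hv.le_expTransform hP ht₀ hv1 ht h)
    (fun t ht x l hl => hu.jump_le_expTransform hm hP ht₀ κ β ht hl) t ht x
  rw [expTransform, expTransform, Real.exp_le_exp] at this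
  linarith

end ImpulseProblem

theorem theorem5 {m : ℕ} (hm : 0 < m) (P : ImpulseProblem m) (hP : P.Standing)
    (t₀ : ℝ) (ht₀ : 0 ≤ t₀) (htT : t₀ < P.T)
    (v₁ v₂ : ℝ → State m → ℝ)
    (hv₁ : v₁ ∈ ImpulseProblem.GrowthClass t₀ P.T) (hv₂ : v₂ ∈ ImpulseProblem.GrowthClass t₀ P.T)
    (hs₁ : P.IsViscositySolution t₀ v₁) (hs₂ : P.IsViscositySolution t₀ v₂) :
    ∀ t ∈ Icc t₀ P.T, ∀ x : State m, v₁ t x = v₂ t x := fun t ht x =>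
  le_antisymm (hs₁.2.le hm hP ht₀ hs₂.1 hv₁.2.2 hv₂.2.2 t ht x)
    (hs₂.2.le hm hP ht₀ hs₁.1 hv₂.2.2 hv₁.2.2 t ht x)
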